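/- An XOR game $G=(f,\pi)$ with finite input sets $X$ (Alice) and $Y$ (Bob) consists of a probability distribution $\pi$ on $X\times Y$ and a function $f:X\times Y\to\{-1,1\}$. For a natural number $d\ge 1$ put $$\omega_{\mathrm{o.w.}-\log d}(G)=\sup_{\gamma}\Big|\sum_{x\in X,\,y\in Y}\pi(x,y)f(x,y)\gamma(x,y)\Big|,$$ where the supremum runs over all correlations of the form $\gamma(x,y)=\int_\Lambda a(x,\lambda)\,b(y,\lambda,m(x,\lambda))\,d\mu(\lambda)$ with $(\Lambda,\mu)$ a probability space (the shared randomness), $a(x,\lambda)\in\{-1,1\}$ Alice's answer, $m(x,\lambda)\in\{1,\dots,d\}$ the classical message that she sends to Bob, and $b(y,\lambda,k)\in\{-1,1\}$ Bob's answer. Let $\omega^*_{\mathrm{o.w.}-\log d}(G)$ be the supremum of the same quantity over all correlations of the form $\gamma(x,y)=\int_\Lambda a(x,\lambda)\,\mathrm{tr}\big(B(y,\lambda)\rho(x,\lambda)\big)\,d\mu(\lambda)$, where $a(x,\lambda)\in\{-1,1\}$, $\rho(x,\lambda)$ is a $d$-dimensional quantum state (a positive semidefinite complex $d\times d$ matrix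 of trace $1$) that Alice sends to Bob, and $B(y,\lambda)=F_{y,\lambda}-F'_{y,\lambda}$ for a two-outcome POVM on $\mathbb C^d$, i.e. positive semidefinite $F_{y,\lambda},F'_{y,\lambda}$ with $F_{y,\lambda}+F'_{y,\lambda}=1$. (All functions of $\lambda$ are measurable.) Theorem. There are universal constants $C,c>0$ such that for every natural number $n\ge 2$ there exists an XOR game $G$ with at most $c\,n^8$ inputs for each of Alice and Bob such that $$\frac{\omega^*_{\mathrm{o.w.}-\log n}(G)}{\omega_{\mathrm{o.w.}-\log n}(G)}\ \ge\ C\,\frac{\sqrt n}{\log n}.$$ -/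

import Mathlib

open MeasureTheory
open scoped ComplexOrder

/-- An XOR game with finite input sets `X` (Alice) and `Y` (Bob): a probability distribution
`prob` on the pairs of inputs and a sign function `sgn : X × Y → {-1, 1}`. -/
structure XORGame (X Y : Type) [Fintype X] [Fintype Y] where
  prob : X → Y → ℝ
  prob_nonneg : ∀ x y, 0 ≤ prob x y
  sum_prob : ∑ x, ∑ y, prob x y = 1
  sgn : X → Y → ℝ
  sgn_eq : ∀ x y, sgn x y = 1 ∨ sgn x y = -1

namespace XORGame

variable {X Y : Type}

/-- The coefficients `T x y = π(x, y) f(x, y)` of the game. -/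
def coeff [Fintype X] [Fintype Y] (G : XORGame X Y) (x : X) (y : Y) : ℝ :=
  G.prob x y * G.sgn x y

/-- The bias `∑ T x y γ x y` of a correlation matrix `γ x y = 𝔼(ab | x, y)`, that is, the
probability of winning minus the probability of losing for a strategy with correlations `γ`. -/
noncomputable def bias [Fintype X] [Fintype Y] (G : XORGame X Y) (γ : X → Y → ℝ) : ℝ :=
  ∑ x, ∑ y, G.coeff x y * γ x y

/-- `γ` is the correlation matrix of a one-way classical strategy with shared randomness
`(Λ, μ)` in which Alice sends one of `d` messages (`log d` bits) to Bob: on input `x` Alice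
answers `a x l` and sends `m x l`; on input `y` and message `k` Bob answers `b y k l`. -/
def IsClassicalOneWay (d : ℕ) (γ : X → Y → ℝ) : Prop :=
  ∃ (Λ : Type) (_ : MeasurableSpace Λ) (μ : Measure Λ) (_ : IsProbabilityMeasure μ)
    (a : X → Λ → ℝ) (m : X → Λ → Fin d) (b : Y → Fin d → Λ → ℝ),
    (∀ x, Measurable (a x)) ∧ (∀ x l, a x l = 1 ∨ a x l = -1) ∧
    (∀ x, Measurable (m x)) ∧
    (∀ y k, Measurable (b y k)) ∧ (∀ y k l, b y k l = 1 ∨ b y k l = -1) ∧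
    ∀ x y, γ x y = ∫ l, a x l * b y (m x l) l ∂μ

/-- `ρ` is a `d`-dimensional quantum state (a density matrix). -/
def IsState {d : ℕ} (ρ : Matrix (Fin d) (Fin d) ℂ) : Prop :=
  ρ.PosSemidef ∧ ρ.trace = 1

/-- `(F, F')` is a two-outcome POVM on a `d`-dimensional system; `F` is the effect of the
outcome `1` and `F'` that of the outcome `-1`. -/
def IsPOVM {d : ℕ} (F F' : Matrix (Fin d) (Fin d) ℂ) : Prop :=
  F.PosSemidef ∧ F'.PosSemidef ∧ F + F' = 1

/-- `γ` is the correlation matrix of a one-way quantum strategy with shared randomness `(Λ, μ)`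
and no shared entanglement, in which Alice sends a `d`-dimensional quantum state (`log d`
qubits) to Bob: on input `x` Alice answers `a x l` and sends the state `ρ x l`; on input `y` Bob
measures the state he receives with the POVM `(F y l, F' y l)` and answers the outcome, whose
expectation is `tr ((F y l - F' y l) ρ x l)`. -/
def IsQuantumOneWay (d : ℕ) (γ : X → Y → ℝ) : Prop :=
  ∃ (Λ : Type) (_ : MeasurableSpace Λ) (μ : Measure Λ) (_ : IsProbabilityMeasure μ)
    (a : X → Λ → ℝ) (ρ : X → Λ → Matrix (Fin d) (Fin d) ℂ)
    (F F' : Y → Λ → Matrix (Fin d) (Fin d) ℂ),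
    (∀ x, Measurable (a x)) ∧ (∀ x l, a x l = 1 ∨ a x l = -1) ∧
    (∀ x i j, Measurable fun l => ρ x l i j) ∧ (∀ x l, IsState (ρ x l)) ∧
    (∀ y i j, Measurable fun l => F y l i j) ∧ (∀ y i j, Measurable fun l => F' y l i j) ∧
    (∀ y l, IsPOVM (F y l) (F' y l)) ∧
    ∀ x y, γ x y = ∫ l, a x l * (((F y l - F' y l) * ρ x l).trace).re ∂μ

/-- The one-way classical value `ω_{o.w.-log d}(G)`: the largest absolute bias that can be
attained when Alice sends `log d` classical bits to Bob. -/
noncomputable def oneWayValue [Fintype X] [Fintype Y] (G : XORGame X Y) (d : ℕ) : ℝ :=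
  sSup {v : ℝ | ∃ γ : X → Y → ℝ, IsClassicalOneWay d γ ∧ v = |G.bias γ|}

/-- The one-way quantum value `ω*_{o.w.-log d}(G)`: the largest absolute bias that can be
attained when Alice sends `log d` qubits to Bob. -/
noncomputable def oneWayQuantumValue [Fintype X] [Fintype Y] (G : XORGame X Y) (d : ℕ) : ℝ :=
  sSup {v : ℝ | ∃ γ : X → Y → ℝ, IsQuantumOneWay d γ ∧ v = |G.bias γ|}

end XORGame

/-!
The game is built from a matrix `T` that is itself a quantum correlation. Alice's question is a
pair of sign vectors of length `n`, read as a state vector `v ∈ {±1}ⁿ / √n` whose first half comes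
from one of them and whose second half from the other. Bob's question selects a shift `a` and a
modulation `b`, hence an observable `B = (W + Wᴴ) / 2` with `W` a weighted shift supported on the
off-diagonal block (first half) × (second half), and `T` is the expectation `⟨v, B v⟩`. Playing this
strategy collects `∑ T²`. The `n²` weighted shifts are a tight frame (`sum_frame_sq`), so that
`∑ T²` is of order `n` for each question of Alice (`sum_payoff_sq_ge`).

A deterministic classical strategy splits Alice's questions into `n` classes. By Cauchy–Schwarz and
the tight frame property, the payoff of a class is controlled by the Hilbert–Schmidt norm of the
signed sum of the block matrices of its members (`classical_payoff_le`). Since there are `n`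
classes, the sum of these norms is governed by the largest fraction `1 / n` of the values
`|⟨M, A⟩|`, for `M` of norm one and `A` the block matrix of a question. For uniformly random sign
vectors `⟨M, A⟩` is a decoupled Rademacher chaos with a subexponential tail (`sum_exp_chaos_le`), so
that these values are of order `log n`. Exponential tails, a grid over all `M` and independent
sampling show that `n ^ 8` questions of Alice suffice (`exists_questions`). The quotient of the two
payoffs is of order `n / (√n log n)`.

`exists_game_ratio_ge` turns the two estimates into a bound for the quotient of the values; it needs
in addition that the values are suprema of bounded sets and that the classical one is positive.
-/

namespace OneWayXOR

/-! ### Exponential moments of Rademacher sums and chaoses -/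

/-- The sign `±1` encoded by a Boolean. -/
def boolSign (b : Bool) : ℝ := if b then 1 else -1

lemma boolSign_mul_self (b : Bool) : boolSign b * boolSign b = 1 := by
  cases b <;> simp [boolSign]

lemma abs_boolSign (b : Bool) : |boolSign b| = 1 := by
  cases b <;> simp [boolSign]

lemma sum_exp_linear_le {ι : Type*} [Fintype ι] [DecidableEq ι] (c : ι → ℝ) :
    ∑ w : ι → Bool, Real.exp (∑ j, c j * boolSign (w j)) ≤
      2 ^ Fintype.card ι * Real.exp ((∑ j, c j ^ 2) / 2) := by
  have h1 : ∑ w : ι → Bool, Real.exp (∑ j, c j * boolSign (w j)) =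
      ∏ j, ∑ b : Bool, Real.exp (c j * boolSign b) := by
    rw [Finset.prod_univ_sum, Fintype.piFinset_univ]
    exact Finset.sum_congr rfl fun w _ => Real.exp_sum _ _
  rw [h1, Finset.sum_div, Real.exp_sum, ← Finset.card_univ, ← Finset.prod_const,
    ← Finset.prod_mul_distrib]
  refine Finset.prod_le_prod (fun j _ => by positivity) fun j _ => ?_
  have := Real.cosh_le_exp_half_sq (c j)
  rw [Real.cosh_eq] at this
  simp only [Fintype.sum_bool, boolSign, if_true, mul_one, Bool.false_eq_true, if_false,
    mul_neg]
  linarith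

lemma sum_exp_norm_sq_step {V : Type*} [NormedAddCommGroup V] [InnerProductSpace ℝ V]
    (a b : V) (t : ℝ) :
    ∑ e : Bool, Real.exp (t * ‖a + boolSign e • b‖ ^ 2) ≤
      2 * Real.exp (t * ‖b‖ ^ 2 + t * (1 + 2 * t * ‖b‖ ^ 2) * ‖a‖ ^ 2) := by
  have h1 : ‖a + b‖ ^ 2 = ‖a‖ ^ 2 + 2 * inner ℝ a b + ‖b‖ ^ 2 := norm_add_sq_real a b
  have h2 : ‖a + -b‖ ^ 2 = ‖a‖ ^ 2 - 2 * inner ℝ a b + ‖b‖ ^ 2 := by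
    rw [← sub_eq_add_neg]; exact norm_sub_sq_real a b
  have h3 := Real.cosh_le_exp_half_sq (2 * t * inner ℝ a b)
  have h4 : (inner ℝ a b : ℝ) ^ 2 ≤ ‖a‖ ^ 2 * ‖b‖ ^ 2 := by
    rw [← mul_pow, ← sq_abs]
    exact pow_le_pow_left₀ (abs_nonneg _) (abs_real_inner_le_norm a b) 2
  have h5 : Real.exp ((2 * t * inner ℝ a b) ^ 2 / 2) ≤
      Real.exp (2 * t ^ 2 * (‖a‖ ^ 2 * ‖b‖ ^ 2)) := by
    apply Real.exp_le_exp.2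
    nlinarith [mul_le_mul_of_nonneg_left h4 (sq_nonneg t)]
  have h6 := h3.trans h5
  rw [Real.cosh_eq] at h6
  simp only [Fintype.sum_bool, boolSign, if_true, one_smul, Bool.false_eq_true, if_false,
    neg_smul, h1, h2]
  calc _ = Real.exp (t * (‖a‖ ^ 2 + ‖b‖ ^ 2)) *
        (Real.exp (2 * t * inner ℝ a b) + Real.exp (-(2 * t * inner ℝ a b))) := by
        rw [mul_add (Real.exp _), ← Real.exp_add, ← Real.exp_add]; congr 2 <;> ring
    _ ≤ Real.exp (t * (‖a‖ ^ 2 + ‖b‖ ^ 2)) *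
        (2 * Real.exp (2 * t ^ 2 * (‖a‖ ^ 2 * ‖b‖ ^ 2))) := by gcongr; linarith
    _ = _ := by rw [mul_left_comm, ← Real.exp_add]; congr 2; ring

/-- Exponential square integrability of a vector-valued Rademacher sum. The translate `a` and the
degrading exponent make the claim stable under conditioning on one sign at a time: passing from
`t` to `t / (1 - 2 t σ²)` subtracts `2 σ²` from the inverse of the exponent. -/
lemma sum_exp_norm_sq_le {V : Type*} [NormedAddCommGroup V] [InnerProductSpace ℝ V] {t : ℝ}
    (ht : 0 ≤ t) (n : ℕ) (m : Fin n → V) (hm : 4 * t * ∑ i, ‖m i‖ ^ 2 ≤ 1) (a : V) :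
    ∑ u : Fin n → Bool, Real.exp (t * ‖a + ∑ i, boolSign (u i) • m i‖ ^ 2) ≤
      2 ^ n * Real.exp (2 * t * ∑ i, ‖m i‖ ^ 2 +
        t / (1 - 2 * t * ∑ i, ‖m i‖ ^ 2) * ‖a‖ ^ 2) := by
  induction n generalizing a with
  | zero => simp
  | succ n ih =>
    set s : ℝ := ∑ i : Fin n, ‖m i.succ‖ ^ 2 with hs
    have hs0 : 0 ≤ s := by positivity
    have hsum : ∑ i, ‖m i‖ ^ 2 = ‖m 0‖ ^ 2 + s := Fin.sum_univ_succ _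
    rw [hsum] at hm ⊢
    have hts : 0 ≤ t * s := by positivity
    have htm : 0 ≤ t * ‖m 0‖ ^ 2 := by positivity
    have hden : 0 < 1 - 2 * t * s := by nlinarith
    have hden' : 0 < 1 - 2 * t * (‖m 0‖ ^ 2 + s) := by nlinarith
    set t' : ℝ := t / (1 - 2 * t * s) with ht'
    have ht'0 : 0 ≤ t' := div_nonneg ht hden.le
    have ht'2 : t' ≤ 2 * t := by
      rw [ht', div_le_iff₀ hden]; nlinarith
    have hstep : t' * (1 + 2 * t' * ‖m 0‖ ^ 2) ≤ t / (1 - 2 * t * (‖m 0‖ ^ 2 + s)) := by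
      have e : t = t' * (1 - 2 * t * s) := (div_mul_cancel₀ t hden.ne').symm
      rw [le_div_iff₀ hden']
      have e2 : 1 - 2 * t * (‖m 0‖ ^ 2 + s) =
          (1 - 2 * t * s) * (1 - 2 * t' * ‖m 0‖ ^ 2) := by
        have : (1 - 2 * t * s) * (1 - 2 * t' * ‖m 0‖ ^ 2) =
          (1 - 2 * t * s) - 2 * (t' * (1 - 2 * t * s)) * ‖m 0‖ ^ 2 := by ring
        rw [this, ← e]; ring
      rw [e2]
      nlinarith [mul_nonneg (mul_nonneg ht'0 hden.le) (sq_nonneg (t' * ‖m 0‖ ^ 2))]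
    rw [← (Fin.consEquiv fun _ => Bool).sum_comp, Fintype.sum_prod_type]
    have hin : ∀ e : Bool, ∑ u : Fin n → Bool, Real.exp (t * ‖a + ∑ i,
        boolSign ((Fin.consEquiv fun _ => Bool) (e, u) i) • m i‖ ^ 2) ≤
        2 ^ n * Real.exp (2 * t * s) * Real.exp (t' * ‖a + boolSign e • m 0‖ ^ 2) := by
      intro e
      have := ih (fun i => m i.succ) (by nlinarith) (a + boolSign e • m 0)
      rw [Real.exp_add, ← mul_assoc] at this
      simpa [Fin.consEquiv, Fin.sum_univ_succ, add_assoc] using this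
    refine (Finset.sum_le_sum fun e _ => hin e).trans ?_
    rw [← Finset.mul_sum]
    calc _ ≤ 2 ^ n * Real.exp (2 * t * s) * (2 * Real.exp (t' * ‖m 0‖ ^ 2 +
          t' * (1 + 2 * t' * ‖m 0‖ ^ 2) * ‖a‖ ^ 2)) := by
          gcongr; exact sum_exp_norm_sq_step _ _ _
      _ ≤ 2 ^ n * Real.exp (2 * t * s) * (2 * Real.exp (2 * t * ‖m 0‖ ^ 2 +
          t / (1 - 2 * t * (‖m 0‖ ^ 2 + s)) * ‖a‖ ^ 2)) := by gcongr
      _ = _ := by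
          rw [show ∀ X : ℝ, 2 * t * (‖m 0‖ ^ 2 + s) + X = 2 * t * s + (2 * t * ‖m 0‖ ^ 2 + X) by
            intro X; ring, Real.exp_add (2 * t * s), pow_succ]
          ring

/-- A decoupled Rademacher chaos of order two has subexponential tails: averaging over `w` leaves
the exponential of a squared norm in `u`. -/
lemma sum_exp_chaos_le {n : ℕ} (M : Fin n → Fin n → ℝ) (hM : ∑ i, ∑ j, M i j ^ 2 ≤ 1) :
    ∑ u : Fin n → Bool, ∑ w : Fin n → Bool,
      Real.exp ((∑ i, ∑ j, M i j * (boolSign (u i) * boolSign (w j))) / 2) ≤ 2 * 4 ^ n := by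
  let r : Fin n → EuclideanSpace ℝ (Fin n) := fun i => WithLp.toLp 2 (M i)
  have hr : ∑ i, ‖r i‖ ^ 2 = ∑ i, ∑ j, M i j ^ 2 := by
    simp [r, EuclideanSpace.real_norm_sq_eq]
  have hrow : ∀ u : Fin n → Bool, ‖0 + ∑ i, boolSign (u i) • r i‖ ^ 2 =
      ∑ j, (∑ i, boolSign (u i) * M i j) ^ 2 := by
    intro u
    simp [r, EuclideanSpace.real_norm_sq_eq]
  have hw : ∀ u : Fin n → Bool, ∑ w : Fin n → Bool,
      Real.exp ((∑ i, ∑ j, M i j * (boolSign (u i) * boolSign (w j))) / 2) ≤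
      2 ^ n * Real.exp (1 / 8 * ‖0 + ∑ i, boolSign (u i) • r i‖ ^ 2) := by
    intro u
    have := sum_exp_linear_le (fun j => (∑ i, boolSign (u i) * M i j) / 2)
    rw [Fintype.card_fin] at this
    refine le_of_eq_of_le (Finset.sum_congr rfl fun w _ => ?_)
      (this.trans_eq ?_)
    · congr 1
      rw [Finset.sum_comm, Finset.sum_div]
      refine Finset.sum_congr rfl fun j _ => ?_
      rw [div_mul_eq_mul_div, Finset.sum_mul]
      congr 1
      exact Finset.sum_congr rfl fun i _ => by ring
    · rw [hrow]
      simp only [div_pow, ← Finset.sum_div]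
      congr 2; ring
  have hu := sum_exp_norm_sq_le (t := 1 / 8) (by norm_num) n r (by rw [hr]; linarith) 0
  have he : Real.exp (2 * (1 / 8) * ∑ i, ‖r i‖ ^ 2 +
        1 / 8 / (1 - 2 * (1 / 8) * ∑ i, ‖r i‖ ^ 2) * ‖(0 : EuclideanSpace ℝ (Fin n))‖ ^ 2) ≤ 2 := by
    rw [hr, norm_zero]
    calc _ ≤ Real.exp (1 / 2) := by
          apply Real.exp_le_exp.2; simp only [ne_eq, OfNat.ofNat_ne_zero, not_false_eq_true,
            zero_pow, mul_zero, add_zero]; linarith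
      _ ≤ 2 := by
          have := Real.abs_exp_sub_one_le (x := 1 / 2) (by norm_num [abs_le])
          rw [abs_of_pos (by norm_num : (0 : ℝ) < 1 / 2)] at this
          linarith [le_abs_self (Real.exp (1 / 2) - 1)]
  refine (Finset.sum_le_sum fun u _ => hw u).trans ?_
  rw [← Finset.mul_sum]
  calc _ ≤ (2 : ℝ) ^ n * (2 ^ n * 2) := by
        gcongr; exact hu.trans (by gcongr)
    _ = 2 * 4 ^ n := by
        rw [show (4 : ℝ) = 2 * 2 by norm_num, mul_pow]; ring

/-! ### Random questions -/

/-- Random sampling, uniformly over a finite family of functions: the sum over the family of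
`exp (∑ x, g i (ω x))` has expectation at most `card ι * exp (2 N μ)` for independent uniform
samples `ω x`, so some `ω` makes each of its terms at most that large. -/
lemma exists_sample {Ω ι : Type*} [Fintype Ω] [Nonempty Ω] [DecidableEq Ω] [Fintype ι] (N : ℕ)
    (g : ι → Ω → ℝ) (hg0 : ∀ i o, 0 ≤ g i o) (hg1 : ∀ i o, g i o ≤ 1) (μ : ℝ)
    (hμ : ∀ i, ∑ o, g i o ≤ Fintype.card Ω * μ) :
    ∃ ω : Fin N → Ω, ∀ i, ∑ x, g i (ω x) ≤ Real.log (Fintype.card ι) + 2 * N * μ := by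
  have hcard : (0 : ℝ) < Fintype.card Ω := by exact_mod_cast Fintype.card_pos
  have hone : ∀ i, ∑ o, Real.exp (g i o) ≤ Fintype.card Ω * Real.exp (2 * μ) := by
    intro i
    have h1 : ∀ o, Real.exp (g i o) ≤ 1 + 2 * g i o := by
      intro o
      have := Real.abs_exp_sub_one_le (x := g i o)
        (by rw [abs_of_nonneg (hg0 i o)]; exact hg1 i o)
      rw [abs_of_nonneg (hg0 i o)] at this
      linarith [le_abs_self (Real.exp (g i o) - 1)]
    calc _ ≤ ∑ o, (1 + 2 * g i o) := Finset.sum_le_sum fun o _ => h1 o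
      _ = Fintype.card Ω + 2 * ∑ o, g i o := by
          rw [Finset.sum_add_distrib, ← Finset.mul_sum]; simp
      _ ≤ Fintype.card Ω * (1 + 2 * μ) := by linarith [hμ i]
      _ ≤ _ := by gcongr; linarith [Real.add_one_le_exp (2 * μ)]
  have htot : ∑ ω : Fin N → Ω, ∑ i, Real.exp (∑ x, g i (ω x)) ≤
      ∑ _ω : Fin N → Ω, Fintype.card ι * Real.exp (2 * N * μ) := by
    rw [Finset.sum_comm]
    have : ∀ i, ∑ ω : Fin N → Ω, Real.exp (∑ x, g i (ω x)) ≤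
        (Fintype.card Ω) ^ N * Real.exp (2 * N * μ) := by
      intro i
      have e : ∑ ω : Fin N → Ω, Real.exp (∑ x, g i (ω x)) =
          ∏ _x : Fin N, ∑ o, Real.exp (g i o) := by
        rw [Finset.prod_univ_sum, Fintype.piFinset_univ]
        exact Finset.sum_congr rfl fun w _ => Real.exp_sum _ _
      rw [e, Finset.prod_const, Finset.card_univ, Fintype.card_fin]
      calc _ ≤ (Fintype.card Ω * Real.exp (2 * μ)) ^ N := by
            gcongr; exact hone i
        _ = _ := by rw [mul_pow, ← Real.exp_nat_mul]; congr 2; ring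
    refine (Finset.sum_le_sum fun i _ => this i).trans_eq ?_
    simp; ring
  obtain ⟨ω, -, hω⟩ := Finset.exists_le_of_sum_le (Finset.univ_nonempty) htot
  refine ⟨ω, fun i => ?_⟩
  have h2 : Real.exp (∑ x, g i (ω x)) ≤ Fintype.card ι * Real.exp (2 * N * μ) :=
    (Finset.single_le_sum (f := fun i => Real.exp (∑ x, g i (ω x)))
      (fun _ _ => (Real.exp_pos _).le) (Finset.mem_univ i)).trans hω
  have hι : (0 : ℝ) < Fintype.card ι := by
    have : Nonempty ι := ⟨i⟩
    exact_mod_cast Fintype.card_pos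
  rw [← Real.exp_le_exp, Real.exp_add, Real.exp_log hι]
  exact h2

/-- Alice's question: a pair `(u, w)` of sign vectors. The state vector only reads `u` on the first
half of the coordinates and `w` on the second half. -/
abbrev SignPair (n : ℕ) : Type := (Fin n → Bool) × (Fin n → Bool)

/-- The unnormalized state vector of `(u, w)`, equal to `u` on the first half of the coordinates
and to `w` on the second half. -/
def stateVec {n : ℕ} (o : SignPair n) (i : Fin n) : ℝ :=
  if 2 * (i : ℕ) < n then boolSign (o.1 i) else boolSign (o.2 i)

/-- The indicator of the block (first half) × (second half) of the index square. -/
def block {n : ℕ} (i j : Fin n) : ℝ := if 2 * (i : ℕ) < n ∧ n ≤ 2 * (j : ℕ) then 1 else 0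

/-- The off-diagonal block of `v vᵀ`, where `v` is the state vector of `o`. -/
def blockMat {n : ℕ} (o : SignPair n) (i j : Fin n) : ℝ :=
  block i j * (stateVec o i * stateVec o j)

lemma stateVec_mul_self {n : ℕ} (o : SignPair n) (i : Fin n) :
    stateVec o i * stateVec o i = 1 := by
  unfold stateVec; split_ifs <;> exact boolSign_mul_self _

lemma abs_stateVec {n : ℕ} (o : SignPair n) (i : Fin n) : |stateVec o i| = 1 := by
  unfold stateVec; split_ifs <;> exact abs_boolSign _

lemma block_nonneg {n : ℕ} (i j : Fin n) : 0 ≤ block i j := by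
  unfold block; split_ifs <;> norm_num

lemma block_le_one {n : ℕ} (i j : Fin n) : block i j ≤ 1 := by
  unfold block; split_ifs <;> norm_num

lemma block_sq {n : ℕ} (i j : Fin n) : block i j ^ 2 = block i j := by
  unfold block; split_ifs <;> norm_num

lemma blockMat_eq {n : ℕ} (o : SignPair n) (i j : Fin n) :
    blockMat o i j = block i j * (boolSign (o.1 i) * boolSign (o.2 j)) := by
  unfold blockMat block stateVec
  split_ifs with h h1 h2 <;> first | rfl | omega | simp

lemma abs_blockMat_le {n : ℕ} (o : SignPair n) (i j : Fin n) : |blockMat o i j| ≤ 1 := by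
  rw [blockMat, abs_mul, abs_mul, abs_stateVec, abs_stateVec, abs_of_nonneg (block_nonneg i j)]
  simpa using block_le_one i j

lemma blockMat_sq {n : ℕ} (o : SignPair n) (i j : Fin n) : blockMat o i j ^ 2 = block i j := by
  rw [blockMat, mul_pow, mul_pow, block_sq, sq (stateVec o i), sq (stateVec o j),
    stateVec_mul_self, stateVec_mul_self]
  ring

/-- The Hilbert–Schmidt pairing of `M` with `blockMat o`. -/
def pairing {n : ℕ} (M : Fin n → Fin n → ℝ) (o : SignPair n) : ℝ :=
  ∑ i, ∑ j, M i j * blockMat o i j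

lemma abs_pairing_le {n : ℕ} (M : Fin n → Fin n → ℝ) (o : SignPair n) :
    |pairing M o| ≤ ∑ i, ∑ j, |M i j| := by
  refine (Finset.abs_sum_le_sum_abs _ _).trans (Finset.sum_le_sum fun i _ =>
    (Finset.abs_sum_le_sum_abs _ _).trans (Finset.sum_le_sum fun j _ => ?_))
  rw [abs_mul]
  exact mul_le_of_le_one_right (abs_nonneg _) (abs_blockMat_le o i j)

lemma abs_pairing_le_card {n : ℕ} (hn : 0 < n) (M : Fin n → Fin n → ℝ)
    (hM : ∑ i, ∑ j, M i j ^ 2 ≤ 1) (o : SignPair n) : |pairing M o| ≤ n := by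
  have hn' : (0 : ℝ) < n := by exact_mod_cast hn
  calc |pairing M o| ≤ ∑ i, ∑ j, |M i j| := abs_pairing_le M o
    _ ≤ ∑ i : Fin n, ∑ j : Fin n, (1 / (2 * n) + n / 2 * M i j ^ 2) := by
        gcongr with i _ j _
        have h : 0 ≤ (n * |M i j| - 1) ^ 2 / (2 * n) := by positivity
        have e : (n * |M i j| - 1) ^ 2 / (2 * n) =
            1 / (2 * n) + n / 2 * |M i j| ^ 2 - |M i j| := by field_simp; ring
        rw [e, sq_abs] at h
        linarith
    _ = n / 2 + n / 2 * ∑ i, ∑ j, M i j ^ 2 := by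
        simp only [Finset.sum_add_distrib, ← Finset.mul_sum, Finset.sum_const, Finset.card_univ,
          Fintype.card_fin, nsmul_eq_mul]
        field_simp
    _ ≤ n / 2 + n / 2 * 1 := by gcongr
    _ = n := by ring

lemma sum_exp_pairing_le {n : ℕ} (M : Fin n → Fin n → ℝ) (hM : ∑ i, ∑ j, M i j ^ 2 ≤ 1) :
    ∑ o : SignPair n, Real.exp (pairing M o / 2) ≤ 2 * 4 ^ n := by
  have h := sum_exp_chaos_le (fun i j => M i j * block i j) (le_trans
    (Finset.sum_le_sum fun i _ => Finset.sum_le_sum fun j _ => by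
    rw [mul_pow, block_sq]
    exact mul_le_of_le_one_right (sq_nonneg _) (block_le_one i j)) hM)
  rw [Fintype.sum_prod_type]
  refine le_of_eq_of_le ?_ h
  simp only [pairing, blockMat_eq, mul_assoc]

lemma sum_excess_pairing_le {n : ℕ} (hn : 2 ≤ n) (M : Fin n → Fin n → ℝ)
    (hM : ∑ i, ∑ j, M i j ^ 2 ≤ 1) :
    ∑ o : SignPair n, max (|pairing M o| - 8 * Real.log n) 0 ≤ 4 ^ n / n := by
  have hn' : (2 : ℝ) ≤ n := by exact_mod_cast hn
  have hpt : ∀ o : SignPair n, max (|pairing M o| - 8 * Real.log n) 0 ≤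
      2 / (n : ℝ) ^ 4 * (Real.exp (pairing M o / 2) + Real.exp (pairing (-M) o / 2)) := by
    intro o
    have hneg : pairing (-M) o = -pairing M o := by simp [pairing]
    have habs : Real.exp (|pairing M o| / 2) ≤
        Real.exp (pairing M o / 2) + Real.exp (pairing (-M) o / 2) := by
      rw [hneg]
      rcases abs_choice (pairing M o) with h | h <;> rw [h]
      · linarith [Real.exp_pos (-pairing M o / 2)]
      · linarith [Real.exp_pos (pairing M o / 2)]
    have hlog : Real.exp (-(8 * Real.log n) / 2) = 1 / (n : ℝ) ^ 4 := by
      rw [show -(8 * Real.log n) / 2 = -((4 : ℕ) * Real.log n) by push_cast; ring, Real.exp_neg,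
        Real.exp_nat_mul, Real.exp_log (by linarith), one_div]
    have hexp : max (|pairing M o| - 8 * Real.log n) 0 ≤
        2 * Real.exp ((|pairing M o| - 8 * Real.log n) / 2) := by
      apply max_le
      · linarith [Real.add_one_le_exp ((|pairing M o| - 8 * Real.log n) / 2)]
      · positivity
    calc _ ≤ _ := hexp
      _ = 2 / (n : ℝ) ^ 4 * Real.exp (|pairing M o| / 2) := by
          rw [sub_eq_add_neg, add_div, Real.exp_add, hlog]; ring
      _ ≤ _ := by gcongr
  refine (Finset.sum_le_sum fun o _ => hpt o).trans ?_
  rw [← Finset.mul_sum, Finset.sum_add_distrib]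
  have h1 := sum_exp_pairing_le M hM
  have h2 := sum_exp_pairing_le (-M) (by simpa using hM)
  calc _ ≤ 2 / (n : ℝ) ^ 4 * (2 * 4 ^ n + 2 * 4 ^ n) := by gcongr
    _ = 8 / (n : ℝ) ^ 3 * (4 ^ n / n) := by field_simp; ring
    _ ≤ 1 * (4 ^ n / n) := by
        gcongr
        rw [div_le_one (by positivity)]
        calc (8 : ℝ) = 2 ^ 3 := by norm_num
          _ ≤ (n : ℝ) ^ 3 := by gcongr
    _ = _ := one_mul _

/-- Rounding towards zero on the grid of mesh `1 / K`, which does not increase absolute values. -/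
lemma exists_grid_approx {K : ℕ} (hK : 0 < K) {x : ℝ} (hx : |x| ≤ 1) :
    ∃ z : Fin (2 * K + 1), |((z : ℝ) - K) / K| ≤ |x| ∧ |x - ((z : ℝ) - K) / K| ≤ 1 / K := by
  have hK' : (0 : ℝ) < K := by exact_mod_cast hK
  wlog h0 : 0 ≤ x generalizing x with H
  · obtain ⟨z, h1, h2⟩ := H (x := -x) (by rwa [abs_neg]) (by linarith)
    have e : ((Fin.rev z : Fin _) : ℝ) - K = -((z : ℝ) - K) := by
      have hz := z.2
      have : ((Fin.rev z : Fin _) : ℕ) + (z : ℕ) = 2 * K := by rw [Fin.val_rev]; omega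
      have : (((Fin.rev z : Fin _) : ℕ) : ℝ) + ((z : ℕ) : ℝ) = 2 * K := by exact_mod_cast this
      linarith
    refine ⟨Fin.rev z, ?_, ?_⟩
    · rw [e, neg_div, abs_neg]; simpa using h1
    · rw [e, neg_div, ← abs_neg]; convert h2 using 2; ring
  · rw [abs_of_nonneg h0] at hx ⊢
    have hxK : 0 ≤ x * K := by positivity
    have hf1 : (⌊x * K⌋₊ : ℝ) ≤ x * K := Nat.floor_le hxK
    have hf2 : x * K < ⌊x * K⌋₊ + 1 := Nat.lt_floor_add_one _
    have hfK : ⌊x * K⌋₊ ≤ K := by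
      have : (⌊x * K⌋₊ : ℝ) ≤ K := by nlinarith
      exact_mod_cast this
    refine ⟨⟨⌊x * K⌋₊ + K, by omega⟩, ?_⟩
    simp only [Nat.cast_add, add_sub_cancel_right]
    constructor
    · rw [abs_of_nonneg (by positivity), div_le_iff₀ hK']; exact hf1
    · have e : x - (⌊x * K⌋₊ : ℝ) / K = (x * K - ⌊x * K⌋₊) / K := by field_simp
      rw [e, abs_of_nonneg (div_nonneg (by linarith) hK'.le)]
      gcongr; linarith

/-- There are `n ^ 8` questions for which no normalized matrix `M` has a large pairing with more
than about a fraction `1 / n` of them: a grid of mesh `1 / n ^ 3` reduces this to finitely many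
`M`, to which random sampling applies. -/
lemma exists_questions {n : ℕ} (hn : 2 ≤ n) :
    ∃ ω : Fin (n ^ 8) → SignPair n, ∀ M : Fin n → Fin n → ℝ, ∑ i, ∑ j, M i j ^ 2 ≤ 1 →
      ∑ x, max (|pairing M (ω x)| - 8 * Real.log n) 0 ≤ 5 * (n : ℝ) ^ 7 := by
  classical
  have hn' : (2 : ℝ) ≤ n := by exact_mod_cast hn
  have hn0 : (0 : ℝ) < n := by linarith
  let grid : (Fin n → Fin n → Fin (2 * n ^ 3 + 1)) → Fin n → Fin n → ℝ :=
    fun z i j => ((z i j : ℝ) - (n ^ 3 : ℕ)) / (n ^ 3 : ℕ)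
  let g : (Fin n → Fin n → Fin (2 * n ^ 3 + 1)) → SignPair n → ℝ := fun z o =>
    if ∑ i, ∑ j, grid z i j ^ 2 ≤ 1 then max (|pairing (grid z) o| - 8 * Real.log n) 0 / n else 0
  have hlog : 0 ≤ Real.log n := Real.log_nonneg (by linarith)
  have hcardΩ : (Fintype.card (SignPair n) : ℝ) = 4 ^ n := by
    simp only [Fintype.card_prod, Fintype.card_fun, Fintype.card_bool, Fintype.card_fin]
    push_cast
    rw [← mul_pow]; norm_num
  obtain ⟨ω, hω⟩ := exists_sample (n ^ 8) g
    (fun z o => by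
      simp only [g]; split_ifs
      · positivity
      · exact le_rfl)
    (fun z o => by
      simp only [g]; split_ifs with h
      · rw [div_le_one hn0]
        apply max_le _ hn0.le
        linarith [abs_pairing_le_card (by omega) _ h o]
      · exact zero_le_one)
    (1 / (n : ℝ) ^ 2)
    (fun z => by
      rw [hcardΩ]
      simp only [g]; split_ifs with h
      · rw [← Finset.sum_div]
        calc _ ≤ (4 : ℝ) ^ n / n / n := by gcongr; exact sum_excess_pairing_le hn _ h
          _ = _ := by field_simp
      · simp only [Finset.sum_const_zero]; positivity)
  have hnet : Real.log (Fintype.card (Fin n → Fin n → Fin (2 * n ^ 3 + 1))) ≤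
      2 * (n : ℝ) ^ 5 := by
    simp only [Fintype.card_fun, Fintype.card_fin, Nat.cast_pow, Real.log_pow]
    have : Real.log ((2 * n ^ 3 + 1 : ℕ) : ℝ) ≤ 2 * (n : ℝ) ^ 3 := by
      have := Real.log_le_sub_one_of_pos (x := ((2 * n ^ 3 + 1 : ℕ) : ℝ)) (by positivity)
      push_cast at this ⊢
      linarith
    calc _ ≤ (n : ℝ) * (n * (2 * (n : ℝ) ^ 3)) := by gcongr
      _ = _ := by ring
  refine ⟨ω, fun M hM => ?_⟩
  have hM1 : ∀ i j, |M i j| ≤ 1 := by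
    intro i j
    rw [← sq_le_one_iff_abs_le_one]
    refine le_trans ?_ hM
    exact (Finset.single_le_sum (f := fun j => M i j ^ 2) (fun _ _ => sq_nonneg _)
      (Finset.mem_univ j)).trans (Finset.single_le_sum (f := fun i => ∑ j, M i j ^ 2)
      (fun _ _ => by positivity) (Finset.mem_univ i))
  have hK : 0 < n ^ 3 := by positivity
  choose z hz1 hz2 using fun i j => exists_grid_approx hK (hM1 i j)
  have hz : ∑ i, ∑ j, grid z i j ^ 2 ≤ 1 := by
    refine le_trans ?_ hM
    exact Finset.sum_le_sum fun i _ => Finset.sum_le_sum fun j _ => sq_le_sq.2 (hz1 i j)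
  have hnear : ∀ o, |pairing M o| ≤ |pairing (grid z) o| + 1 / n := by
    intro o
    have e : pairing M o = pairing (grid z) o + pairing (fun i j => M i j - grid z i j) o := by
      simp only [pairing, ← Finset.sum_add_distrib]
      exact Finset.sum_congr rfl fun i _ => Finset.sum_congr rfl fun j _ => by ring
    have h2 : |pairing (fun i j => M i j - grid z i j) o| ≤ 1 / n := by
      refine (abs_pairing_le _ _).trans ?_
      calc _ ≤ ∑ _i : Fin n, ∑ _j : Fin n, 1 / ((n ^ 3 : ℕ) : ℝ) := by
            gcongr with i _ j _; exact hz2 i j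
        _ = 1 / n := by
            simp only [Finset.sum_const, Finset.card_univ, Fintype.card_fin, nsmul_eq_mul]
            push_cast; field_simp
    rw [e]
    exact (abs_add_le _ _).trans (by gcongr)
  have hsum := hω z
  simp only [g, if_pos hz, ← Finset.sum_div] at hsum
  rw [div_le_iff₀ hn0] at hsum
  calc _ ≤ ∑ x, (max (|pairing (grid z) (ω x)| - 8 * Real.log n) 0 + 1 / n) := by
        gcongr with x _
        have h1n : (0 : ℝ) ≤ 1 / n := by positivity
        apply max_le
        · linarith [hnear (ω x), le_max_left (|pairing (grid z) (ω x)| - 8 * Real.log n) 0]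
        · linarith [le_max_right (|pairing (grid z) (ω x)| - 8 * Real.log n) 0]
    _ = ∑ x, max (|pairing (grid z) (ω x)| - 8 * Real.log n) 0 + (n : ℝ) ^ 7 := by
        rw [Finset.sum_add_distrib]
        simp only [Finset.sum_const, Finset.card_univ, Fintype.card_fin, nsmul_eq_mul]
        push_cast; field_simp
    _ ≤ (2 * (n : ℝ) ^ 5 + 2 * (n ^ 8 : ℕ) * (1 / (n : ℝ) ^ 2)) * n + (n : ℝ) ^ 7 := by
        gcongr
        exact hsum.trans (by gcongr)
    _ = 2 * (n : ℝ) ^ 6 + 3 * (n : ℝ) ^ 7 := by push_cast; field_simp; ring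
    _ ≤ _ := by
        have : (n : ℝ) ^ 6 ≤ (n : ℝ) ^ 7 := pow_le_pow_right₀ (by linarith) (by norm_num)
        linarith

/-- The estimate behind the classical bound: however the questions are signed and
distributed over `n` messages, the Hilbert–Schmidt norms of the signed sums of each class add up
to at most `O(n ^ 8 log n)`. By duality each norm is the pairing with a normalized matrix. -/
lemma exists_questions_sum_norm_le {n : ℕ} (hn : 2 ≤ n) :
    ∃ ω : Fin (n ^ 8) → SignPair n, ∀ (a : Fin (n ^ 8) → ℝ) (m : Fin (n ^ 8) → Fin n),
      (∀ x, |a x| ≤ 1) →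
      ∑ k, √(∑ i, ∑ j, (∑ x with m x = k, a x * blockMat (ω x) i j) ^ 2) ≤
        16 * Real.log n * (n : ℝ) ^ 8 := by
  obtain ⟨ω, hω⟩ := exists_questions hn
  refine ⟨ω, fun a m ha => ?_⟩
  have hn' : (2 : ℝ) ≤ n := by exact_mod_cast hn
  have hlog : Real.log 2 ≤ Real.log n := Real.log_le_log (by norm_num) hn'
  have hl2 := Real.log_two_gt_d9
  have key : ∀ k, √(∑ i, ∑ j, (∑ x with m x = k, a x * blockMat (ω x) i j) ^ 2) ≤
      ∑ x with m x = k, 8 * Real.log n + 5 * (n : ℝ) ^ 7 := by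
    intro k
    set D : Fin n → Fin n → ℝ := fun i j => ∑ x with m x = k, a x * blockMat (ω x) i j with hD
    set r : ℝ := √(∑ i, ∑ j, D i j ^ 2) with hr
    have hr2 : r ^ 2 = ∑ i, ∑ j, D i j ^ 2 := Real.sq_sqrt (by positivity)
    have hr0 : 0 ≤ r := Real.sqrt_nonneg _
    rcases hr0.eq_or_lt with h0 | hpos
    · rw [← h0]; positivity
    have hM : ∑ i, ∑ j, (D i j / r) ^ 2 ≤ 1 := by
      simp only [div_pow, ← Finset.sum_div, ← hr2]
      exact (div_self (by positivity)).le
    have hdual : r = ∑ x with m x = k, a x * pairing (fun i j => D i j / r) (ω x) := by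
      calc r = (∑ i, ∑ j, D i j ^ 2) / r := by rw [← hr2]; field_simp
        _ = ∑ i, ∑ j, D i j / r * ∑ x with m x = k, a x * blockMat (ω x) i j := by
            simp only [Finset.sum_div]
            exact Finset.sum_congr rfl fun i _ => Finset.sum_congr rfl fun j _ => by
              rw [← show D i j = ∑ x with m x = k, a x * blockMat (ω x) i j from rfl]; ring
        _ = _ := by
            simp only [pairing, Finset.mul_sum]
            symm
            rw [Finset.sum_comm]
            refine Finset.sum_congr rfl fun i _ => ?_
            rw [Finset.sum_comm]
            exact Finset.sum_congr rfl fun j _ => Finset.sum_congr rfl fun x _ => by ring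
    calc r = _ := hdual
      _ ≤ ∑ x with m x = k, (8 * Real.log n +
          max (|pairing (fun i j => D i j / r) (ω x)| - 8 * Real.log n) 0) := by
          gcongr with x _
          have h1 : a x * pairing (fun i j => D i j / r) (ω x) ≤
              |pairing (fun i j => D i j / r) (ω x)| := by
            refine (le_abs_self _).trans ?_
            rw [abs_mul]
            exact mul_le_of_le_one_left (abs_nonneg _) (ha x)
          linarith [le_max_left (|pairing (fun i j => D i j / r) (ω x)| - 8 * Real.log n) 0]
      _ ≤ _ := by
          rw [Finset.sum_add_distrib]
          gcongr
          refine le_trans (Finset.sum_le_sum_of_subset_of_nonneg (Finset.filter_subset _ _)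
            fun _ _ _ => le_max_right _ _) (hω _ hM)
  refine (Finset.sum_le_sum fun k _ => key k).trans ?_
  rw [Finset.sum_add_distrib, Finset.sum_fiberwise]
  simp only [Finset.sum_const, Finset.card_univ, Fintype.card_fin, nsmul_eq_mul]
  push_cast
  have h8 : (0 : ℝ) < (n : ℝ) ^ 8 := by positivity
  nlinarith [mul_pos h8 (show (0 : ℝ) < 8 * Real.log n - 5 by linarith)]

/-! ### Bob's frame of modulated shifts -/

/-- The Hartley (real Fourier) functions, scaled so as to be bounded by `1`. -/
noncomputable def hartley {n : ℕ} (b i : Fin n) : ℝ :=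
  (Real.cos (2 * Real.pi * b * i / n) + Real.sin (2 * Real.pi * b * i / n)) / 2

lemma abs_hartley_le {n : ℕ} (b i : Fin n) : |hartley b i| ≤ 1 := by
  rw [hartley, abs_div, abs_two, div_le_one two_pos]
  refine (abs_add_le _ _).trans ?_
  linarith [Real.abs_cos_le_one (2 * Real.pi * b * i / n),
    Real.abs_sin_le_one (2 * Real.pi * b * i / n)]

lemma sum_exp_root {n : ℕ} (hn : 0 < n) (k : ℤ) :
    ∑ b : Fin n, Complex.exp (((2 * Real.pi * b * k / n : ℝ) : ℂ) * Complex.I) =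
      if (n : ℤ) ∣ k then (n : ℂ) else 0 := by
  have hn0 : (n : ℂ) ≠ 0 := by exact_mod_cast hn.ne'
  set z : ℂ := Complex.exp (2 * Real.pi * Complex.I * (k / n)) with hz
  have h1 : ∀ b : Fin n, Complex.exp (((2 * Real.pi * b * k / n : ℝ) : ℂ) * Complex.I) =
      z ^ (b : ℕ) := by
    intro b
    rw [hz, ← Complex.exp_nat_mul]
    congr 1; push_cast; ring
  simp only [h1]
  rw [Fin.sum_univ_eq_sum_range fun b => z ^ b]
  have hzn : z ^ n = 1 := by
    rw [hz, ← Complex.exp_nat_mul, Complex.exp_eq_one_iff]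
    exact ⟨k, by field_simp⟩
  have hz1 : z = 1 ↔ (n : ℤ) ∣ k := by
    rw [hz, Complex.exp_eq_one_iff]
    have hpi : (2 * Real.pi * Complex.I : ℂ) ≠ 0 := Complex.two_pi_I_ne_zero
    constructor
    · rintro ⟨q, hq⟩
      refine ⟨q, ?_⟩
      rw [mul_comm (q : ℂ)] at hq
      have := mul_left_cancel₀ hpi hq
      rw [div_eq_iff hn0] at this
      rw [mul_comm]
      exact_mod_cast this
    · rintro ⟨q, rfl⟩
      exact ⟨q, by push_cast; field_simp⟩
  split_ifs with h
  · simp [hz1.2 h]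
  · have hne : z ≠ 1 := fun h' => h (hz1.1 h')
    rw [geom_sum_eq hne, hzn, sub_self, zero_div]

lemma sum_hartley_mul {n : ℕ} (i j : Fin n) :
    ∑ b, hartley b i * hartley b j = if i = j then (n : ℝ) / 4 else 0 := by
  have hn : 0 < n := i.pos
  have e : ∀ b : Fin n, hartley b i * hartley b j =
      (Complex.exp (((2 * Real.pi * b * ((i - j : ℤ) : ℝ) / n : ℝ) : ℂ) * Complex.I)).re / 4 +
      (Complex.exp (((2 * Real.pi * b * ((i + j : ℤ) : ℝ) / n : ℝ) : ℂ) * Complex.I)).im / 4 := by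
    intro b
    rw [Complex.exp_ofReal_mul_I_re, Complex.exp_ofReal_mul_I_im]
    have h1 : 2 * Real.pi * b * ((i - j : ℤ) : ℝ) / n =
        2 * Real.pi * b * i / n - 2 * Real.pi * b * j / n := by push_cast; ring
    have h2 : 2 * Real.pi * b * ((i + j : ℤ) : ℝ) / n =
        2 * Real.pi * b * i / n + 2 * Real.pi * b * j / n := by push_cast; ring
    rw [h1, h2, Real.cos_sub, Real.sin_add, hartley, hartley]
    ring
  simp only [e, Finset.sum_add_distrib, ← Finset.sum_div, ← Complex.re_sum, ← Complex.im_sum,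
    sum_exp_root hn]
  have him : (if (n : ℤ) ∣ (i + j : ℤ) then (n : ℂ) else 0).im = 0 := by split_ifs <;> simp
  rw [him]
  have hij : (n : ℤ) ∣ (i - j : ℤ) ↔ i = j := by
    constructor
    · intro h
      have := Int.eq_zero_of_abs_lt_dvd h (by rw [abs_lt]; omega)
      ext; omega
    · rintro rfl; simp
  simp only [hij]
  split_ifs <;> simp

/-- The modulated shifts `i ↦ i + a` with weights `hartley b` form a tight frame of the space of
real matrices. -/
lemma sum_frame_sq {n : ℕ} [NeZero n] (D : Fin n → Fin n → ℝ) :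
    ∑ a : Fin n, ∑ b, (∑ i, hartley b i * D i (i + a)) ^ 2 = n / 4 * ∑ i, ∑ j, D i j ^ 2 := by
  have h : ∀ a : Fin n, ∑ b, (∑ i, hartley b i * D i (i + a)) ^ 2 =
      n / 4 * ∑ i, D i (i + a) ^ 2 := by
    intro a
    calc _ = ∑ b, ∑ i, ∑ j, hartley b i * hartley b j * (D i (i + a) * D j (j + a)) := by
          refine Finset.sum_congr rfl fun b _ => ?_
          rw [sq, Finset.sum_mul_sum]
          exact Finset.sum_congr rfl fun i _ => Finset.sum_congr rfl fun j _ => by ring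
      _ = ∑ i, ∑ j, (∑ b, hartley b i * hartley b j) * (D i (i + a) * D j (j + a)) := by
          rw [Finset.sum_comm]
          refine Finset.sum_congr rfl fun i _ => ?_
          rw [Finset.sum_comm]
          exact Finset.sum_congr rfl fun j _ => (Finset.sum_mul _ _ _).symm
      _ = _ := by
          rw [Finset.mul_sum]
          refine Finset.sum_congr rfl fun i _ => ?_
          simp only [sum_hartley_mul, ite_mul, zero_mul, Finset.sum_ite_eq, Finset.mem_univ,
            if_true]
          ring
  simp only [h, ← Finset.mul_sum]
  rw [Finset.sum_comm]
  congr 1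
  exact Finset.sum_congr rfl fun i _ => Equiv.sum_comp (Equiv.addLeft i) fun j => D i j ^ 2

lemma sum_abs_frame_le {n : ℕ} [NeZero n] (D : Fin n → Fin n → ℝ) :
    ∑ a : Fin n, ∑ b, |∑ i, hartley b i * D i (i + a)| ≤
      n * (√n / 2) * √(∑ i, ∑ j, D i j ^ 2) := by
  have hcs := sq_sum_le_card_mul_sum_sq (s := (Finset.univ : Finset (Fin n × Fin n)))
    (f := fun p => |∑ i, hartley p.2 i * D i (i + p.1)|)
  simp only [sq_abs, Fintype.sum_prod_type, sum_frame_sq, Finset.card_univ, Fintype.card_prod,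
    Fintype.card_fin] at hcs
  refine (Real.le_sqrt_of_sq_le hcs).trans_eq ?_
  rw [show ((n * n : ℕ) : ℝ) * (n / 4 * ∑ i, ∑ j, D i j ^ 2) =
    ((n : ℝ) * (1 / 2)) ^ 2 * (n * ∑ i, ∑ j, D i j ^ 2) by push_cast; ring,
    Real.sqrt_mul (sq_nonneg _), Real.sqrt_sq (by positivity), Real.sqrt_mul (by positivity)]
  ring

/-- The unnormalized game coefficient of the question `o` to Alice and `(a, b)` to Bob. -/
noncomputable def payoff {n : ℕ} [NeZero n] (o : SignPair n) (q : Fin n × Fin n) : ℝ :=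
  (∑ i, hartley q.2 i * blockMat o i (i + q.1)) / n

lemma sum_block_ge {n : ℕ} (hn : 2 ≤ n) :
    3 / 16 * (n : ℝ) ^ 2 ≤ ∑ i : Fin n, ∑ j : Fin n, block i j := by
  have h1 : ∀ i j : Fin n, block i j =
      (if 2 * (i : ℕ) < n then (1 : ℝ) else 0) * (if n ≤ 2 * (j : ℕ) then 1 else 0) := by
    intro i j; unfold block; split_ifs <;> first | (exfalso; omega) | simp
  have h2 : ∑ i : Fin n, (if 2 * (i : ℕ) < n then (1 : ℝ) else 0) = ((n + 1) / 2 : ℕ) := by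
    rw [Fin.sum_univ_eq_sum_range fun i => if 2 * i < n then (1 : ℝ) else 0, Finset.sum_boole]
    have : (Finset.range n).filter (fun i => 2 * i < n) = Finset.range ((n + 1) / 2) := by
      ext i; simp only [Finset.mem_filter, Finset.mem_range]; omega
    rw [this, Finset.card_range]
  have h3 : ∑ i : Fin n, (if n ≤ 2 * (i : ℕ) then (1 : ℝ) else 0) = (n / 2 : ℕ) := by
    rw [Fin.sum_univ_eq_sum_range fun i => if n ≤ 2 * i then (1 : ℝ) else 0, Finset.sum_boole]
    have : (Finset.range n).filter (fun i => n ≤ 2 * i) = Finset.Ico ((n + 1) / 2) n := by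
      ext i; simp only [Finset.mem_filter, Finset.mem_range, Finset.mem_Ico]; omega
    rw [this, Nat.card_Ico]
    congr 1; omega
  simp only [h1, ← Finset.mul_sum, ← Finset.sum_mul, h2, h3]
  rcases Nat.even_or_odd' n with ⟨k, rfl | rfl⟩
  · rw [show (2 * k + 1) / 2 = k by omega, show 2 * k / 2 = k by omega]
    push_cast; nlinarith
  · rw [show (2 * k + 1 + 1) / 2 = k + 1 by omega, show (2 * k + 1) / 2 = k by omega]
    have hk : (1 : ℝ) ≤ k := by exact_mod_cast (by omega : 1 ≤ k)
    push_cast; nlinarith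

lemma sum_payoff_sq_ge {n : ℕ} [NeZero n] (hn : 2 ≤ n) (o : SignPair n) :
    3 / 64 * (n : ℝ) ≤ ∑ q, payoff o q ^ 2 := by
  have hn0 : (0 : ℝ) < n := by exact_mod_cast (by omega : 0 < n)
  simp only [Fintype.sum_prod_type, payoff, div_pow, ← Finset.sum_div, sum_frame_sq, blockMat_sq]
  rw [le_div_iff₀ (by positivity)]
  nlinarith [sum_block_ge hn, mul_le_mul_of_nonneg_left (sum_block_ge hn) hn0.le]

/-! ### Lower bound for quantum strategies -/

open Matrix in
/-- A weighted shift `W` with weights at most `1` in absolute value gives the observable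
`(W + Wᴴ) / 2`: here `2 + W + Wᴴ = (1 + W) (1 + W)ᴴ + (1 - W Wᴴ)` is positive. -/
lemma exists_povm {n : ℕ} [NeZero n] (w : Fin n → ℝ) (hw : ∀ i, |w i| ≤ 1) (a : Fin n) :
    ∃ F F' : Matrix (Fin n) (Fin n) ℂ, XORGame.IsPOVM F F' ∧ ∀ ρ : Fin n → Fin n → ℝ,
      (∀ i j, ρ i j = ρ j i) →
      (((F - F') * Matrix.of fun i j => (ρ i j : ℂ)).trace).re = ∑ i, w i * ρ i (i + a) := by
  set W : Matrix (Fin n) (Fin n) ℂ := Matrix.of fun i j => if j = i + a then (w i : ℂ) else 0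
    with hW
  have hWW : W * Wᴴ = Matrix.diagonal fun i => ((w i ^ 2 : ℝ) : ℂ) := by
    ext i j
    rw [Matrix.mul_apply, Matrix.diagonal_apply]
    simp only [hW, Matrix.conjTranspose_apply, Matrix.of_apply, ite_mul, zero_mul,
      Finset.sum_ite_eq', Finset.mem_univ, if_true, add_left_inj]
    by_cases h : i = j
    · subst h; simp [sq]
    · simp [h]
  have hD : (1 - W * Wᴴ).PosSemidef := by
    have : (1 - W * Wᴴ) = Matrix.diagonal fun i => ((1 - w i ^ 2 : ℝ) : ℂ) := by
      rw [hWW, ← Matrix.diagonal_one, Matrix.diagonal_sub]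
      simp
    rw [this]
    apply Matrix.PosSemidef.diagonal
    intro i
    have := (sq_le_one_iff_abs_le_one (w i)).2 (hw i)
    rw [Pi.zero_apply, Complex.zero_le_real]
    linarith
  have hP : ((1 / 4 : ℝ) • ((1 + W) * (1 + W)ᴴ + (1 - W * Wᴴ))).PosSemidef :=
    ((Matrix.posSemidef_self_mul_conjTranspose _).add hD).smul (by norm_num)
  have hM : ((1 / 4 : ℝ) • ((1 - W) * (1 - W)ᴴ + (1 - W * Wᴴ))).PosSemidef :=
    ((Matrix.posSemidef_self_mul_conjTranspose _).add hD).smul (by norm_num)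
  refine ⟨_, _, ⟨hP, hM, ?_⟩, fun ρ hρ => ?_⟩
  · rw [← smul_add]
    have : ((1 + W) * (1 + W)ᴴ + (1 - W * Wᴴ)) + ((1 - W) * (1 - W)ᴴ + (1 - W * Wᴴ)) =
        (4 : ℝ) • 1 := by
      rw [show (4 : ℝ) • (1 : Matrix (Fin n) (Fin n) ℂ) = 1 + 1 + 1 + 1 by
        rw [show (4 : ℝ) = 1 + 1 + 1 + 1 by norm_num]; simp only [add_smul, one_smul]]
      simp only [Matrix.conjTranspose_add, Matrix.conjTranspose_sub, Matrix.conjTranspose_one]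
      noncomm_ring
    rw [this, smul_smul]; norm_num
  · rw [← smul_sub]
    have : ((1 + W) * (1 + W)ᴴ + (1 - W * Wᴴ)) - ((1 - W) * (1 - W)ᴴ + (1 - W * Wᴴ)) =
        (2 : ℝ) • (W + Wᴴ) := by
      rw [show (2 : ℝ) • (W + Wᴴ) = (W + Wᴴ) + (W + Wᴴ) by
        rw [show (2 : ℝ) = 1 + 1 by norm_num]; simp only [add_smul, one_smul]]
      simp only [Matrix.conjTranspose_add, Matrix.conjTranspose_sub, Matrix.conjTranspose_one]
      noncomm_ring
    have h1 : (W * Matrix.of fun i j => (ρ i j : ℂ)).trace =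
        ((∑ i, w i * ρ i (i + a) : ℝ) : ℂ) := by
      simp only [Matrix.trace, Matrix.diag_apply, Matrix.mul_apply, hW, Matrix.of_apply, ite_mul,
        zero_mul, Finset.sum_ite_eq', Finset.mem_univ, if_true]
      push_cast
      exact Finset.sum_congr rfl fun i _ => by rw [hρ]
    have h2 : (Wᴴ * Matrix.of fun i j => (ρ i j : ℂ)).trace =
        ((∑ i, w i * ρ i (i + a) : ℝ) : ℂ) := by
      rw [Matrix.trace_mul_comm]
      simp only [Matrix.trace, Matrix.diag_apply, Matrix.mul_apply, hW, Matrix.of_apply,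
        Matrix.conjTranspose_apply]
      push_cast
      refine Finset.sum_congr rfl fun i _ => ?_
      rw [Finset.sum_eq_single (i + a) (fun j _ hj => by simp [hj]) (by simp)]
      simp [mul_comm]
    rw [this, smul_smul, Matrix.smul_mul, Matrix.trace_smul, Matrix.add_mul, Matrix.trace_add,
      h1, h2, Complex.smul_re, ← Complex.ofReal_add, Complex.ofReal_re, smul_eq_mul]
    ring

lemma isState_stateVec {n : ℕ} (hn : 0 < n) (o : SignPair n) :
    XORGame.IsState (Matrix.of fun i j : Fin n => ((stateVec o i * stateVec o j / n : ℝ) : ℂ)) := by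
  have hn0 : (n : ℝ) ≠ 0 := by exact_mod_cast hn.ne'
  constructor
  · have : (Matrix.of fun i j : Fin n => ((stateVec o i * stateVec o j / n : ℝ) : ℂ)) =
        (1 / n : ℝ) • Matrix.vecMulVec (fun i => (stateVec o i : ℂ))
          (star fun i => (stateVec o i : ℂ)) := by
      ext i j
      simp [Matrix.vecMulVec_apply]
      ring
    rw [this]
    exact (Matrix.posSemidef_vecMulVec_self_star _).smul (by positivity)
  · simp only [Matrix.trace, Matrix.diag_apply, Matrix.of_apply, stateVec_mul_self]
    rw [← Complex.ofReal_sum]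
    simp [hn.ne']

/-- The payoff matrix itself is the correlation matrix of a quantum strategy: Alice sends her
normalized state vector and Bob measures a modulated shift restricted to the block. -/
lemma isQuantumOneWay_payoff {n : ℕ} [NeZero n] {X Y : Type} (o : X → SignPair n)
    (q : Y → Fin n × Fin n) :
    XORGame.IsQuantumOneWay n fun x y => payoff (o x) (q y) := by
  have hw : ∀ (y : Y) i, |hartley (q y).2 i * block i (i + (q y).1)| ≤ 1 := by
    intro y i
    rw [abs_mul, abs_of_nonneg (block_nonneg _ _)]
    exact mul_le_one₀ (abs_hartley_le _ _) (block_nonneg _ _) (block_le_one _ _)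
  choose F F' hF hval using fun y => exists_povm _ (hw y) (q y).1
  refine ⟨Unit, inferInstance, Measure.dirac (), inferInstance, fun _ _ => 1,
    fun x _ => Matrix.of fun i j => ((stateVec (o x) i * stateVec (o x) j / n : ℝ) : ℂ),
    fun y _ => F y, fun y _ => F' y, fun _ => measurable_const, fun _ _ => Or.inl rfl,
    fun _ _ _ => measurable_const, fun x _ => isState_stateVec (NeZero.pos n) (o x),
    fun _ _ _ => measurable_const, fun _ _ _ => measurable_const, fun y _ => hF y,
    fun x y => ?_⟩
  rw [integral_const, hval y (fun i j => stateVec (o x) i * stateVec (o x) j / n)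
    fun i j => by ring]
  simp only [probReal_univ, one_smul, one_mul, payoff, blockMat, Finset.sum_div]
  exact Finset.sum_congr rfl fun i _ => by ring

/-! ### Values of games -/

lemma trace_mul_nonneg {d : ℕ} {F ρ : Matrix (Fin d) (Fin d) ℂ} (hF : F.PosSemidef)
    (hρ : ρ.PosSemidef) : 0 ≤ (F * ρ).trace := by
  obtain ⟨m, v, rfl⟩ := Matrix.posSemidef_iff_eq_sum_vecMulVec.1 hρ
  rw [Matrix.mul_sum, Matrix.trace_sum]
  refine Finset.sum_nonneg fun i _ => ?_
  rw [Matrix.mul_vecMulVec, Matrix.trace_vecMulVec, dotProduct_comm]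
  exact hF.dotProduct_mulVec_nonneg _

lemma abs_trace_povm_le {d : ℕ} {F F' ρ : Matrix (Fin d) (Fin d) ℂ} (hF : XORGame.IsPOVM F F')
    (hρ : XORGame.IsState ρ) : |(((F - F') * ρ).trace).re| ≤ 1 := by
  have h1 := (Complex.le_def.1 (trace_mul_nonneg hF.1 hρ.1)).1
  have h2 := (Complex.le_def.1 (trace_mul_nonneg hF.2.1 hρ.1)).1
  have h3 : ((F * ρ).trace).re + ((F' * ρ).trace).re = 1 := by
    rw [← Complex.add_re, ← Matrix.trace_add, ← Matrix.add_mul, hF.2.2, Matrix.one_mul, hρ.2,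
      Complex.one_re]
  rw [Matrix.sub_mul, Matrix.trace_sub, Complex.sub_re, abs_le]
  rw [Complex.zero_re] at h1 h2
  constructor <;> linarith

lemma abs_le_one_of_isQuantumOneWay {X Y : Type} {d : ℕ} {γ : X → Y → ℝ} (hγ : XORGame.IsQuantumOneWay d γ)
    (x : X) (y : Y) : |γ x y| ≤ 1 := by
  obtain ⟨Λ, _, μ, _, a, ρ, F, F', -, ha, -, hρ, -, -, hF, h⟩ := hγ
  rw [h x y, ← Real.norm_eq_abs]
  refine (norm_integral_le_of_norm_le_const (C := 1) (.of_forall fun l => ?_)).trans_eq (by simp)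
  rw [norm_mul, Real.norm_eq_abs, Real.norm_eq_abs]
  have h1 : |a x l| = 1 := by rcases ha x l with h | h <;> simp [h]
  rw [h1, one_mul]
  exact abs_trace_povm_le (hF y l) (hρ x l)

lemma isClassicalOneWay_deterministic {X Y : Type} {d : ℕ} {a : X → ℝ} (m : X → Fin d) {b : Y → Fin d → ℝ}
    (ha : ∀ x, a x = 1 ∨ a x = -1) (hb : ∀ y k, b y k = 1 ∨ b y k = -1) :
    XORGame.IsClassicalOneWay d fun x y => a x * b y (m x) :=
  ⟨Unit, inferInstance, Measure.dirac (), inferInstance, fun x _ => a x, fun x _ => m x,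
    fun y k _ => b y k, fun _ => measurable_const, fun x _ => ha x, fun _ => measurable_const,
    fun _ _ => measurable_const, fun y k _ => hb y k, fun x y => by simp⟩

section Values

variable {X Y : Type} [Fintype X] [Fintype Y]

lemma abs_bias_le_sum (G : XORGame X Y) {γ : X → Y → ℝ} (hγ : ∀ x y, |γ x y| ≤ 1) :
    |G.bias γ| ≤ ∑ x, ∑ y, |G.coeff x y| := by
  refine (Finset.abs_sum_le_sum_abs _ _).trans (Finset.sum_le_sum fun x _ =>
    (Finset.abs_sum_le_sum_abs _ _).trans (Finset.sum_le_sum fun y _ => ?_))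
  rw [abs_mul]
  exact mul_le_of_le_one_right (abs_nonneg _) (hγ x y)

lemma le_oneWayQuantumValue (G : XORGame X Y) {d : ℕ} {γ : X → Y → ℝ}
    (hγ : XORGame.IsQuantumOneWay d γ) : |G.bias γ| ≤ G.oneWayQuantumValue d := by
  refine le_csSup ⟨∑ x, ∑ y, |G.coeff x y|, ?_⟩ ⟨γ, hγ, rfl⟩
  rintro _ ⟨γ', hγ', rfl⟩
  exact abs_bias_le_sum G (abs_le_one_of_isQuantumOneWay hγ')

/-- Shared randomness does not help: a bound for deterministic strategies holds for all. -/
lemma abs_bias_le_of_isClassicalOneWay (G : XORGame X Y) {d : ℕ} {K : ℝ}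
    (hK : ∀ (a : X → ℝ) (m : X → Fin d) (b : Y → Fin d → ℝ), (∀ x, a x = 1 ∨ a x = -1) →
      (∀ y k, b y k = 1 ∨ b y k = -1) → |G.bias fun x y => a x * b y (m x)| ≤ K)
    {γ : X → Y → ℝ} (hγ : XORGame.IsClassicalOneWay d γ) : |G.bias γ| ≤ K := by
  obtain ⟨Λ, _, μ, _, a, m, b, ham, ha, hm, hbm, hb, h⟩ := hγ
  have hmeas : ∀ x y, Measurable fun l => a x l * b y (m x l) l := fun x y =>
    (ham x).mul ((measurable_from_prod_countable_right (f := fun p : Fin d × Λ => b y p.1 p.2)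
      fun k => hbm y k).comp ((hm x).prodMk measurable_id))
  have hint : ∀ x y, Integrable (fun l => a x l * b y (m x l) l) μ := fun x y =>
    Integrable.of_bound (hmeas x y).aestronglyMeasurable 1 (.of_forall fun l => by
      rcases ha x l with h1 | h1 <;> rcases hb y (m x l) l with h2 | h2 <;> simp [h1, h2])
  have e : G.bias γ = ∫ l, G.bias (fun x y => a x l * b y (m x l) l) ∂μ := by
    simp only [XORGame.bias, h]
    rw [integral_finsetSum _ fun x _ => integrable_finsetSum _ fun y _ => (hint x y).const_mul _]
    refine Finset.sum_congr rfl fun x _ => ?_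
    rw [integral_finsetSum _ fun y _ => (hint x y).const_mul _]
    exact Finset.sum_congr rfl fun y _ => (integral_const_mul _ _).symm
  rw [e, ← Real.norm_eq_abs]
  refine (norm_integral_le_of_norm_le_const (C := K) (.of_forall fun l => ?_)).trans_eq (by simp)
  exact hK (fun x => a x l) (fun x => m x l) (fun y k => b y k l) (fun x => ha x l)
    fun y k => hb y k l

lemma oneWayValue_le (G : XORGame X Y) {d : ℕ} {K : ℝ} (hK0 : 0 ≤ K)
    (hK : ∀ (a : X → ℝ) (m : X → Fin d) (b : Y → Fin d → ℝ), (∀ x, a x = 1 ∨ a x = -1) →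
      (∀ y k, b y k = 1 ∨ b y k = -1) → |G.bias fun x y => a x * b y (m x)| ≤ K) :
    G.oneWayValue d ≤ K := by
  refine Real.sSup_le ?_ hK0
  rintro _ ⟨γ, hγ, rfl⟩
  exact abs_bias_le_of_isClassicalOneWay G hK hγ

/-- The classical value of a nonzero game is positive, even without communication: flipping a
single answer of Alice changes some column sum, and Bob answers with the signs of the column
sums. -/
lemma oneWayValue_pos (G : XORGame X Y) {d : ℕ} (hd : 0 < d) {x₀ : X} {y₀ : Y}
    (h0 : G.coeff x₀ y₀ ≠ 0) : 0 < G.oneWayValue d := by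
  classical
  obtain ⟨a, ha, hne⟩ : ∃ a : X → ℝ, (∀ x, a x = 1 ∨ a x = -1) ∧
      ∑ x, G.coeff x y₀ * a x ≠ 0 := by
    by_contra! H
    have h1 := H (fun _ => 1) fun _ => Or.inl rfl
    have h2 := H (fun x => if x = x₀ then -1 else 1) fun x => by
      by_cases h : x = x₀ <;> simp [h]
    have h3 : ∑ x, G.coeff x y₀ * (1 - if x = x₀ then -1 else 1) = 0 := by
      simp only [mul_sub, Finset.sum_sub_distrib, h1, h2, sub_zero]
    rw [Finset.sum_eq_single x₀ (fun x _ hx => by simp [hx]) (by simp)] at h3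
    apply h0
    simp only [if_true] at h3
    linarith
  let b : Y → Fin d → ℝ := fun y _ => if 0 ≤ ∑ x, G.coeff x y * a x then 1 else -1
  have hb : ∀ y k, b y k = 1 ∨ b y k = -1 := by
    intro y k; simp only [b]; split_ifs <;> simp
  let m : X → Fin d := fun _ => ⟨0, hd⟩
  have hγ : XORGame.IsClassicalOneWay d fun x y => a x * b y (m x) :=
    isClassicalOneWay_deterministic m ha hb
  have hbias : G.bias (fun x y => a x * b y (m x)) = ∑ y, |∑ x, G.coeff x y * a x| := by
    rw [XORGame.bias, Finset.sum_comm]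
    refine Finset.sum_congr rfl fun y _ => ?_
    simp only [← mul_assoc, b, ← Finset.sum_mul]
    split_ifs with h
    · rw [abs_of_nonneg h, mul_one]
    · rw [abs_of_neg (not_le.1 h), mul_neg_one]
  have hpos : 0 < G.bias (fun x y => a x * b y (m x)) := by
    rw [hbias]
    exact Finset.sum_pos' (fun _ _ => abs_nonneg _) ⟨y₀, Finset.mem_univ _, abs_pos.2 hne⟩
  refine (abs_pos.2 hpos.ne').trans_le (le_csSup ⟨∑ x, ∑ y, |G.coeff x y|, ?_⟩ ⟨_, hγ, rfl⟩)
  rintro _ ⟨γ', hγ', rfl⟩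
  refine abs_bias_le_of_isClassicalOneWay G (fun a m b ha hb => abs_bias_le_sum G fun x y => ?_)
    hγ'
  rcases ha x with h1 | h1 <;> rcases hb y (m x) with h2 | h2 <;> simp [h1, h2]

/-- The game with `π = |T| / ∑ |T|` and `f` the sign of `T`. -/
lemma exists_game (T : X → Y → ℝ) (hT : 0 < ∑ x, ∑ y, |T x y|) :
    ∃ G : XORGame X Y, ∀ x y, G.coeff x y = T x y / ∑ x, ∑ y, |T x y| := by
  refine ⟨⟨fun x y => |T x y| / ∑ x, ∑ y, |T x y|, fun x y => by positivity, ?_,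
    fun x y => if 0 ≤ T x y then 1 else -1, fun x y => by split_ifs <;> simp⟩, fun x y => ?_⟩
  · simp only [← Finset.sum_div]
    exact div_self hT.ne'
  · simp only [XORGame.coeff]
    split_ifs with h
    · rw [abs_of_nonneg h, mul_one]
    · rw [abs_of_neg (not_le.1 h)]; ring

/-- A matrix `T` that is itself a quantum correlation is a good witness for its own game, with
quantum payoff the sum of its squared entries. -/
lemma exists_game_ratio_ge {T : X → Y → ℝ} {d : ℕ} (hd : 0 < d)
    (hT : XORGame.IsQuantumOneWay d T) {P K : ℝ} (hP : 0 < P) (hK0 : 0 ≤ K)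
    (hTP : P ≤ ∑ x, ∑ y, T x y ^ 2)
    (hK : ∀ (a : X → ℝ) (m : X → Fin d) (b : Y → Fin d → ℝ), (∀ x, |a x| ≤ 1) →
      (∀ y k, |b y k| ≤ 1) → |∑ x, ∑ y, T x y * (a x * b y (m x))| ≤ K) :
    ∃ G : XORGame X Y, P / K ≤ G.oneWayQuantumValue d / G.oneWayValue d := by
  obtain ⟨x₀, y₀, h0⟩ : ∃ x y, T x y ≠ 0 := by
    by_contra! H
    simp only [H, ne_eq, OfNat.ofNat_ne_zero, not_false_eq_true, zero_pow,
      Finset.sum_const_zero] at hTP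
    linarith
  have hZ : 0 < ∑ x, ∑ y, |T x y| :=
    Finset.sum_pos' (fun _ _ => by positivity) ⟨x₀, Finset.mem_univ _,
      Finset.sum_pos' (fun _ _ => abs_nonneg _) ⟨y₀, Finset.mem_univ _, abs_pos.2 h0⟩⟩
  obtain ⟨G, hG⟩ := exists_game T hZ
  set Z := ∑ x, ∑ y, |T x y|
  have hbias : ∀ γ, G.bias γ = (∑ x, ∑ y, T x y * γ x y) / Z := by
    intro γ
    simp only [XORGame.bias, hG, Finset.sum_div]
    exact Finset.sum_congr rfl fun x _ => Finset.sum_congr rfl fun y _ => by ring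
  have hquantum : P / Z ≤ G.oneWayQuantumValue d := by
    refine le_trans ?_ ((le_abs_self _).trans (le_oneWayQuantumValue G hT))
    rw [hbias]
    gcongr
    simpa only [sq] using hTP
  have hclassical : G.oneWayValue d ≤ K / Z := by
    refine oneWayValue_le G (by positivity) fun a m b ha hb => ?_
    rw [hbias, abs_div, abs_of_pos hZ]
    gcongr
    refine hK a m b (fun x => ?_) fun y k => ?_
    · rcases ha x with h | h <;> simp [h]
    · rcases hb y k with h | h <;> simp [h]
  have hpos : 0 < G.oneWayValue d :=
    oneWayValue_pos G hd (x₀ := x₀) (y₀ := y₀) (by rw [hG]; exact div_ne_zero h0 hZ.ne')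
  have hq0 : 0 ≤ G.oneWayQuantumValue d := le_trans (by positivity) hquantum
  refine ⟨G, ?_⟩
  calc P / K = P / Z / (K / Z) := (div_div_div_cancel_right₀ hZ.ne' P K).symm
    _ ≤ _ := by gcongr

end Values

/-! ### Upper bound for classical strategies -/

/-- Bob's `n ^ 8` questions: each pair (shift, modulation) is repeated `n ^ 6` times, so that the
number of questions matches Alice's. -/
lemma exists_uniform_map (n : ℕ) : ∃ q : Fin (n ^ 8) → Fin n × Fin n,
    ∀ f : Fin n × Fin n → ℝ, ∑ y, f (q y) = (n : ℝ) ^ 6 * ∑ p, f p := by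
  let e : Fin (n ^ 8) ≃ (Fin n × Fin n) × Fin (n ^ 6) :=
    (Fintype.equivFinOfCardEq (by simp; ring)).symm
  refine ⟨fun y => (e y).1, fun f => ?_⟩
  rw [e.sum_comp fun p => f p.1, Fintype.sum_prod_type]
  simp [Finset.mul_sum]

/-- A deterministic strategy splits Alice's questions into `n` classes, and the payoff collected
from a class is at most the `ℓ¹` norm of the frame coefficients of its signed matrix sum. -/
lemma classical_payoff_le {n : ℕ} [NeZero n] {ω : Fin (n ^ 8) → SignPair n}
    {q : Fin (n ^ 8) → Fin n × Fin n}
    (hω : ∀ (a : Fin (n ^ 8) → ℝ) (m : Fin (n ^ 8) → Fin n), (∀ x, |a x| ≤ 1) →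
      ∑ k, √(∑ i, ∑ j, (∑ x with m x = k, a x * blockMat (ω x) i j) ^ 2) ≤
        16 * Real.log n * (n : ℝ) ^ 8)
    (hq : ∀ f : Fin n × Fin n → ℝ, ∑ y, f (q y) = (n : ℝ) ^ 6 * ∑ p, f p)
    {a : Fin (n ^ 8) → ℝ} (m : Fin (n ^ 8) → Fin n) {b : Fin (n ^ 8) → Fin n → ℝ}
    (ha : ∀ x, |a x| ≤ 1) (hb : ∀ y k, |b y k| ≤ 1) :
    |∑ x, ∑ y, payoff (ω x) (q y) * (a x * b y (m x))| ≤
      8 * √n * Real.log n * (n : ℝ) ^ 14 := by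
  have hn0 : (0 : ℝ) < n := by exact_mod_cast NeZero.pos n
  have h1 : ∑ x, ∑ y, payoff (ω x) (q y) * (a x * b y (m x)) =
      ∑ y, ∑ k, b y k * ∑ x with m x = k, a x * payoff (ω x) (q y) := by
    rw [Finset.sum_comm]
    refine Finset.sum_congr rfl fun y _ => ?_
    rw [← Finset.sum_fiberwise (s := Finset.univ) (g := m)]
    refine Finset.sum_congr rfl fun k _ => ?_
    rw [Finset.mul_sum]
    refine Finset.sum_congr rfl fun x hx => ?_
    rw [(Finset.mem_filter.1 hx).2]; ring
  have h2 : ∀ (k : Fin n) (p : Fin n × Fin n), ∑ x with m x = k, a x * payoff (ω x) p =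
      (∑ i, hartley p.2 i * ∑ x with m x = k, a x * blockMat (ω x) i (i + p.1)) / n := by
    intro k p
    simp only [payoff, Finset.mul_sum, Finset.sum_div]
    rw [Finset.sum_comm]
    exact Finset.sum_congr rfl fun i _ => Finset.sum_congr rfl fun x _ => by ring
  rw [h1]
  calc _ ≤ ∑ y, ∑ k, |∑ x with m x = k, a x * payoff (ω x) (q y)| := by
        refine (Finset.abs_sum_le_sum_abs _ _).trans (Finset.sum_le_sum fun y _ =>
          (Finset.abs_sum_le_sum_abs _ _).trans (Finset.sum_le_sum fun k _ => ?_))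
        rw [abs_mul]
        exact mul_le_of_le_one_left (abs_nonneg _) (hb y k)
    _ = ∑ k, (n : ℝ) ^ 6 * ∑ p, |∑ x with m x = k, a x * payoff (ω x) p| := by
        rw [Finset.sum_comm]
        exact Finset.sum_congr rfl fun k _ =>
          hq fun p => |∑ x with m x = k, a x * payoff (ω x) p|
    _ ≤ ∑ k, (n : ℝ) ^ 6 * (√n / 2 *
          √(∑ i, ∑ j, (∑ x with m x = k, a x * blockMat (ω x) i j) ^ 2)) := by
        gcongr with k _
        simp only [h2, abs_div, Nat.abs_cast, ← Finset.sum_div]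
        rw [div_le_iff₀ hn0, Fintype.sum_prod_type]
        exact (sum_abs_frame_le fun i j => ∑ x with m x = k, a x * blockMat (ω x) i j).trans_eq
          (by ring)
    _ ≤ (n : ℝ) ^ 6 * (√n / 2 * (16 * Real.log n * (n : ℝ) ^ 8)) := by
        rw [← Finset.mul_sum, ← Finset.mul_sum]
        gcongr
        exact hω a m ha
    _ = _ := by ring

end OneWayXOR

theorem theorem4 :
    ∃ C c : ℝ, 0 < C ∧ 0 < c ∧ ∀ n : ℕ, 2 ≤ n →
      ∃ m : ℕ, (m : ℝ) ≤ c * (n : ℝ) ^ 8 ∧ ∃ G : XORGame (Fin m) (Fin m),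
        C * (Real.sqrt n / Real.log n) ≤ G.oneWayQuantumValue n / G.oneWayValue n := by
  refine ⟨3 / 512, 1, by norm_num, one_pos, fun n hn => ⟨n ^ 8, by push_cast; linarith, ?_⟩⟩
  have : NeZero n := ⟨by omega⟩
  have hn' : (2 : ℝ) ≤ n := by exact_mod_cast hn
  have hn0 : (0 : ℝ) < n := by linarith
  have hlog : 0 < Real.log n := Real.log_pos (by linarith)
  obtain ⟨ω, hω⟩ := OneWayXOR.exists_questions_sum_norm_le hn
  obtain ⟨q, hq⟩ := OneWayXOR.exists_uniform_map n
  have hpayoff : 3 / 64 * (n : ℝ) ^ 15 ≤ ∑ x, ∑ y, OneWayXOR.payoff (ω x) (q y) ^ 2 := by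
    calc 3 / 64 * (n : ℝ) ^ 15 = ∑ _x : Fin (n ^ 8), (n : ℝ) ^ 6 * (3 / 64 * n) := by
          simp only [Finset.sum_const, Finset.card_univ, Fintype.card_fin, nsmul_eq_mul]
          push_cast; ring
      _ ≤ _ := by
          refine Finset.sum_le_sum fun x _ => ?_
          rw [hq fun p => OneWayXOR.payoff (ω x) p ^ 2]
          gcongr
          exact OneWayXOR.sum_payoff_sq_ge hn (ω x)
  obtain ⟨G, hG⟩ := OneWayXOR.exists_game_ratio_ge (NeZero.pos n)
    (OneWayXOR.isQuantumOneWay_payoff ω q) (P := 3 / 64 * (n : ℝ) ^ 15)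
    (K := 8 * √n * Real.log n * (n : ℝ) ^ 14) (by positivity) (by positivity) hpayoff
    fun _ m _ ha hb => OneWayXOR.classical_payoff_le hω hq m ha hb
  refine ⟨G, le_of_eq_of_le ?_ hG⟩
  have hs : (n : ℝ) ^ 15 = √n * √n * (n : ℝ) ^ 14 := by rw [Real.mul_self_sqrt hn0.le]; ring
  rw [hs]
  field_simp
  norm_num
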